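/- There is an absolute constant $C > 0$ such that for every real number $\alpha > 0$ there exists $\beta = \beta(\alpha) > 0$, depending only on $\alpha$, with the following property. For every prime $p$, every subgroup $H$ of the multiplicative group $\mathbb{F}_p^\times$ with $|H| > p^{\alpha}$, and every non-trivial additive character $\psi : \mathbb{F}_p \to \mathbb{C}$ (that is, $\psi(x) = \exp(2\pi i x\xi/p)$ for some $\xi \in \mathbb{F}_p^\times$), $$\Bigl|\sum_{x \in H} \psi(x)\Bigr| \le C\, p^{-\beta}\, |H|.$$ -/

import Mathlib

/-! Suppose the sum over `H` is at least `|H| / s`, with `s` a tiny power of `p`. Then the set of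
frequencies with large sums (`largeSpectrum`) is `H`-invariant and has at least `|H|` elements. Its
members correlate, so either it has large additive energy or it grows by a factor `q`, a power of
`p`, when `s` is replaced by `2 * s ^ 2` (`largeSpectrum_energy`). Growth cannot recur until the set
outnumbers `F_p`, so at some scale the energy is large.

This is contradictory (`mul_card_largeSpectrum_lt`). Balog–Szemerédi–Gowers extracts a dense subset
`A` with small `A - A`, and by invariance many `h ∈ H` make `A - h • A` small
(`exists_many_isCloseDilate`). Multipliers with this property are stable under field operations at
polynomial cost, and boundedly many rounds of sum-product growth produce every element of `F_p`
(`isCloseDilate_of_lt_card_pow`). But `A - r • A` cannot be small for all `r` unless `A` is tiny or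
nearly everything (`card_mul_card_le_of_forall_isCloseDilate`), while `A` has intermediate size. -/

open Finset
open scoped Pointwise ComplexConjugate

/-! ### Additive energy and the Balog–Szemerédi–Gowers theorem. -/

section BalogSzemerediGowers

variable {G : Type*} [AddCommGroup G] [DecidableEq G]

/-- The elements of `A` that remain in `A` after subtracting `d`; their number is the number of
representations of `d` as a difference of two elements of `A`. -/
def selfInterShift (A : Finset G) (d : G) : Finset G := {a ∈ A | a - d ∈ A}

lemma mem_selfInterShift {A : Finset G} {d a : G} :
    a ∈ selfInterShift A d ↔ a ∈ A ∧ a - d ∈ A := by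
  simp [selfInterShift]

lemma card_selfInterShift_eq_sum (A : Finset G) (d : G) :
    (#(selfInterShift A d) : ℝ) = ∑ a ∈ A, (if a - d ∈ A then (1 : ℝ) else 0) := by
  simp [selfInterShift]

variable [Fintype G]

lemma sum_ite_sub_mem (A : Finset G) (a : G) :
    ∑ d : G, (if a - d ∈ A then (1 : ℝ) else 0) = #A := by
  refine ((Equiv.subLeft a).sum_comp (fun x => if x ∈ A then (1 : ℝ) else 0)).trans ?_
  simp

lemma sum_card_selfInterShift (A : Finset G) :
    ∑ d : G, (#(selfInterShift A d) : ℝ) = (#A : ℝ) ^ 2 := by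
  simp_rw [card_selfInterShift_eq_sum]
  rw [sum_comm]
  simp_rw [sum_ite_sub_mem]
  simp [sq]

lemma sum_ite_sub_mem_mul (A : Finset G) (a b : G) :
    ∑ d : G, (if a - d ∈ A then (1 : ℝ) else 0) * (if b - d ∈ A then (1 : ℝ) else 0)
      = #(selfInterShift A (a - b)) := by
  have h : ∑ x : G, (if x ∈ A then (1 : ℝ) else 0) * (if x - (a - b) ∈ A then (1 : ℝ) else 0)
      = #(selfInterShift A (a - b)) := by
    simp_rw [card_selfInterShift_eq_sum, ite_mul, one_mul, zero_mul]
    rw [sum_ite_mem, univ_inter]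
  rw [← h, ← (Equiv.subLeft a).sum_comp]
  refine sum_congr rfl fun d _ => ?_
  simp only [Equiv.subLeft_apply]
  rw [sub_sub_cancel, show b - (a - d) = d - (a - b) by abel]

lemma sum_card_filter_selfInterShift (A : Finset G) (P : G → G → Prop) [DecidableRel P] :
    ∑ d : G, (#{x ∈ selfInterShift A d ×ˢ selfInterShift A d | P x.1 x.2} : ℝ)
      = ∑ x ∈ A ×ˢ A with P x.1 x.2, (#(selfInterShift A (x.1 - x.2)) : ℝ) := by
  simp_rw [← sum_ite_sub_mem_mul]
  rw [sum_comm]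
  refine sum_congr rfl fun d _ => ?_
  simp_rw [ite_zero_mul_ite_zero, mul_one]
  rw [sum_boole, filter_filter]
  congr 2
  ext x
  simp only [mem_filter, mem_product, mem_selfInterShift]
  tauto

/-- **Balog–Szemerédi–Gowers theorem**: a set of large additive energy has a large subset with
small difference set. -/
theorem exists_subset_card_sub_le_of_energy {A : Finset G} (hA : A.Nonempty) {K : ℝ} (hK : 0 < K)
    (hE : (#A : ℝ) ^ 3 ≤ K * ∑ d : G, (#(selfInterShift A d) : ℝ) ^ 2) :
    ∃ B ⊆ A, (#A : ℝ) ≤ 4 * K * #B ∧ (#(B - B) : ℝ) ≤ 2 ^ 14 * K ^ 4 * #B := by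
  classical
  set r : G → ℝ := fun d => (#(selfInterShift A d) : ℝ) with hr
  have hr0 : ∀ d, 0 ≤ r d := fun d => Nat.cast_nonneg _
  have hApos : (0 : ℝ) < #A := by exact_mod_cast hA.card_pos
  let P : G → G → Prop := fun a b => 32 * K * r (a - b) < #A
  let bad : G → ℝ := fun d => (#{x ∈ selfInterShift A d ×ˢ selfInterShift A d | P x.1 x.2} : ℝ)
  have hbad : 32 * K * ∑ d, bad d ≤ (#A : ℝ) ^ 3 := by
    have h0 : ∑ d, bad d = ∑ x ∈ A ×ˢ A with P x.1 x.2, r (x.1 - x.2) :=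
      sum_card_filter_selfInterShift A P
    rw [h0, mul_sum]
    calc ∑ x ∈ A ×ˢ A with P x.1 x.2, 32 * K * r (x.1 - x.2)
        ≤ ∑ x ∈ A ×ˢ A with P x.1 x.2, (#A : ℝ) :=
          sum_le_sum fun x hx => (mem_filter.1 hx).2.le
      _ ≤ ∑ x ∈ A ×ˢ A, (#A : ℝ) :=
          sum_le_sum_of_subset_of_nonneg (filter_subset _ _) fun _ _ _ => hApos.le
      _ = (#A : ℝ) ^ 3 := by simp [card_product]; ring
  -- Averaging over `d`: this single inequality yields both a large `X` and at most `#X ^ 2 / 8` bad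
  -- pairs in it.
  obtain ⟨d, -, hd⟩ : ∃ d ∈ (univ : Finset G),
      r d * #A < 2 * K * (r d ^ 2 - 8 * bad d) := by
    refine exists_lt_of_sum_lt ?_
    rw [← sum_mul, sum_card_selfInterShift, ← mul_sum, sum_sub_distrib, ← mul_sum]
    have : 0 < (#A : ℝ) ^ 3 := by positivity
    nlinarith
  set X := selfInterShift A d with hX
  have hrX : r d = #X := rfl
  rw [hrX] at hd
  have hbad0 : 0 ≤ bad d := Nat.cast_nonneg _
  have hXpos : (0 : ℝ) < #X := by
    rcases (Nat.cast_nonneg (α := ℝ) #X).eq_or_lt with h | h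
    · rw [← h] at hd
      nlinarith [mul_nonneg hK.le hbad0]
    · exact h
  have hAX : (#A : ℝ) ≤ 2 * K * #X := by
    have : #X * (#A : ℝ) < #X * (2 * K * #X) := by nlinarith [mul_nonneg hK.le hbad0]
    exact (lt_of_mul_lt_mul_left this hXpos.le).le
  have hbadX : 8 * bad d ≤ (#X : ℝ) ^ 2 := by
    have : 0 < 2 * K * ((#X : ℝ) ^ 2 - 8 * bad d) := lt_of_le_of_lt (by positivity) hd
    have := pos_of_mul_pos_right this (by positivity)
    linarith
  let bd : G → ℕ := fun a => #{b ∈ X | P a b}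
  have hbd : bad d = ∑ a ∈ X, (bd a : ℝ) := by
    simp only [bad, bd]
    rw [← hX]
    rw [card_filter, sum_product]
    push_cast
    simp
  let B := {a ∈ X | 4 * bd a ≤ #X}
  have hBX : B ⊆ X := filter_subset _ _
  have hB : (#X : ℝ) ≤ 2 * #B := by
    have h1 : #X = #B + #{a ∈ X | ¬ 4 * bd a ≤ #X} :=
      (card_filter_add_card_filter_not _).symm
    have h2 : #{a ∈ X | ¬ 4 * bd a ≤ #X} * (#X : ℝ) ≤ 4 * bad d := by
      rw [hbd, mul_sum, ← nsmul_eq_mul]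
      refine (card_nsmul_le_sum _ (fun a => 4 * (bd a : ℝ)) _ fun a ha => ?_).trans
        (sum_le_sum_of_subset_of_nonneg (filter_subset _ _) fun _ _ _ =>
          mul_nonneg (by norm_num) (Nat.cast_nonneg _))
      have := (mem_filter.1 ha).2
      push Not at this
      exact_mod_cast this.le
    have h3 : (#X : ℝ) = #B + #{a ∈ X | ¬ 4 * bd a ≤ #X} := by exact_mod_cast h1
    have h4 : (2 * #{a ∈ X | ¬ 4 * bd a ≤ #X} : ℝ) ≤ #X := by
      refine le_of_mul_le_mul_right ?_ hXpos
      nlinarith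
    linarith
  -- Two elements of `B` have at least `#X / 2` common good partners `b`, and each writes `a - a'`
  -- as `(a - b) - (a' - b)` with both terms popular differences. The total over all `e` is only `#A
  -- ^ 4` (`htot`), which bounds `#(B - B)`.
  have hcount : ∀ e ∈ B - B, (#X : ℝ) * (#A : ℝ) ^ 2 ≤ 2 ^ 11 * K ^ 2 * ∑ c, r c * r (c - e) := by
    intro e he
    obtain ⟨a, ha, a', ha', rfl⟩ := mem_sub.1 he
    have ha2 := (mem_filter.1 ha).2
    have ha2' := (mem_filter.1 ha').2
    let W := {b ∈ X | ¬ P a b ∧ ¬ P a' b}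
    have hW : (#X : ℝ) ≤ 2 * #W := by
      have : X ⊆ W ∪ ({b ∈ X | P a b} ∪ {b ∈ X | P a' b}) := by
        intro b hb
        simp only [W, mem_union, mem_filter]
        tauto
      have h1 := card_le_card this
      have h2 := card_union_le W ({b ∈ X | P a b} ∪ {b ∈ X | P a' b})
      have h3 := card_union_le {b ∈ X | P a b} {b ∈ X | P a' b}
      have : #X ≤ 2 * #W := by
        simp only [bd] at ha2 ha2'
        omega
      exact_mod_cast this
    have h1 : ∑ b ∈ W, r (a - b) * r (a' - b) ≤ ∑ c, r c * r (c - (a - a')) := by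
      have : ∑ b ∈ W, r (a - b) * r (a' - b)
          = ∑ c ∈ W.image (fun b => a - b), r c * r (c - (a - a')) := by
        rw [sum_image (fun x _ y _ h => sub_right_injective h)]
        refine sum_congr rfl fun b _ => ?_
        rw [sub_sub_sub_cancel_left]
      rw [this]
      exact sum_le_sum_of_subset_of_nonneg (subset_univ _) fun _ _ _ => mul_nonneg (hr0 _) (hr0 _)
    have h2 : #W * (#A : ℝ) ^ 2 ≤ 2 ^ 10 * K ^ 2 * ∑ b ∈ W, r (a - b) * r (a' - b) := by
      rw [mul_sum, ← nsmul_eq_mul]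
      refine card_nsmul_le_sum _ _ _ fun b hb => ?_
      obtain ⟨-, hb1, hb2⟩ := mem_filter.1 hb
      simp only [P, not_lt] at hb1 hb2
      calc (#A : ℝ) ^ 2 = #A * #A := sq _
        _ ≤ (32 * K * r (a - b)) * (32 * K * r (a' - b)) :=
          mul_le_mul hb1 hb2 hApos.le (hApos.le.trans hb1)
        _ = _ := by ring
    calc (#X : ℝ) * (#A : ℝ) ^ 2 ≤ 2 * #W * (#A : ℝ) ^ 2 := by gcongr
      _ ≤ 2 * (2 ^ 10 * K ^ 2 * ∑ b ∈ W, r (a - b) * r (a' - b)) := by linarith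
      _ ≤ 2 * (2 ^ 10 * K ^ 2 * ∑ c, r c * r (c - (a - a'))) := by gcongr
      _ = _ := by ring
  have htot : ∑ e : G, ∑ c : G, r c * r (c - e) = (#A : ℝ) ^ 4 := by
    rw [sum_comm]
    simp_rw [← mul_sum]
    have : ∀ c : G, ∑ e : G, r (c - e) = (#A : ℝ) ^ 2 := fun c => by
      rw [← sum_card_selfInterShift]
      exact (Equiv.subLeft c).sum_comp r
    simp_rw [this]
    rw [← sum_mul, sum_card_selfInterShift]
    ring
  have hfin : #(B - B) * ((#X : ℝ) * (#A : ℝ) ^ 2) ≤ 2 ^ 11 * K ^ 2 * (#A : ℝ) ^ 4 := by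
    rw [← htot, mul_sum, ← nsmul_eq_mul]
    refine (card_nsmul_le_sum _ _ _ hcount).trans
      (sum_le_sum_of_subset_of_nonneg (subset_univ _) fun _ _ _ => mul_nonneg (by positivity)
        (sum_nonneg fun _ _ => mul_nonneg (hr0 _) (hr0 _)))
  refine ⟨B, hBX.trans (filter_subset _ _), by nlinarith, ?_⟩
  have h5 : #(B - B) * (#X : ℝ) ≤ 2 ^ 11 * K ^ 2 * (#A : ℝ) ^ 2 := by
    refine le_of_mul_le_mul_right ?_ (pow_pos hApos 2)
    nlinarith
  have h6 : (#A : ℝ) ^ 2 ≤ (2 * K * #X) ^ 2 := pow_le_pow_left₀ hApos.le hAX 2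
  have h7 : #(B - B) * (#X : ℝ) ≤ 2 ^ 13 * K ^ 4 * #X * #X := by
    refine h5.trans ?_
    calc 2 ^ 11 * K ^ 2 * (#A : ℝ) ^ 2 ≤ 2 ^ 11 * K ^ 2 * (2 * K * #X) ^ 2 := by gcongr
      _ = _ := by ring
  have h8 := le_of_mul_le_mul_right h7 hXpos
  calc (#(B - B) : ℝ) ≤ 2 ^ 13 * K ^ 4 * #X := h8
    _ ≤ 2 ^ 13 * K ^ 4 * (2 * #B) := by gcongr
    _ = _ := by ring

end BalogSzemerediGowers

/-! ### Dilates close to `A`: stability under field operations, and sum-product growth. -/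

section RuzsaCalculus

lemma card_add_add_sub_add_le {G : Type*} [AddCommGroup G] [DecidableEq G] {A : Finset G}
    (hA : A.Nonempty) {L : ℝ} (hL : (#(A - A) : ℝ) ≤ L * #A) :
    (#(A + A + A - (A + A)) : ℝ) ≤ L ^ 5 * #A := by
  have h := pluennecke_ruzsa_inequality_nsmul_sub_nsmul_sub hA A 3 2
  simp only [succ_nsmul, zero_nsmul, zero_add] at h
  have h' : (#(A + A + A - (A + A)) : ℝ) ≤ (#(A - A) / #A : ℝ) ^ 5 * #A := by
    have := (NNRat.cast_le (K := ℝ)).2 h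
    push_cast at this
    exact this
  have hApos : (0 : ℝ) < #A := by exact_mod_cast hA.card_pos
  refine h'.trans ?_
  gcongr
  exact (div_le_iff₀ hApos).2 hL

variable {F : Type*} [Field F] [DecidableEq F]

lemma Finset.smul_finset_sub_distrib (r : F) (A B : Finset F) :
    r • (A - B) = r • A - r • B :=
  image_image₂_distrib fun _ _ => smul_sub r _ _

/-- The dilate `r • A` is close to `A`: the difference set `A - r • A` has at most `M * #A`
elements. -/
def IsCloseDilate (A : Finset F) (M : ℝ) (r : F) : Prop := (#(A - r • A) : ℝ) ≤ M * #A

namespace IsCloseDilate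

variable {A : Finset F} {M : ℝ} {r s : F}

lemma mono {M' : ℝ} (h : IsCloseDilate A M r) (hM : M ≤ M') : IsCloseDilate A M' r :=
  le_trans h (by gcongr)

lemma zero (hM : 1 ≤ M) : IsCloseDilate A M 0 := by
  rcases A.eq_empty_or_nonempty with rfl | hA
  · simp [IsCloseDilate]
  · have : A - (0 : F) • A = A := by simp [zero_smul_finset hA]
    rw [IsCloseDilate, this]
    exact le_mul_of_one_le_left (Nat.cast_nonneg _) hM

/-- Ruzsa's triangle inequality through `r • A`, since `r • A - (r * s) • A` is a dilate of `A - s •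
A`. -/
lemma mul (hA : A.Nonempty) (hM : 1 ≤ M) (hr : IsCloseDilate A M r) (hs : IsCloseDilate A M s) :
    IsCloseDilate A (M ^ 2) (r * s) := by
  rcases eq_or_ne r 0 with rfl | hr0
  · rw [zero_mul]
    exact zero (one_le_pow₀ hM)
  have h := ruzsa_triangle_inequality_sub_sub_sub A (r • A) ((r * s) • A)
  have h1 : #(r • A) = #A := card_smul_finset₀ hr0 A
  have h2 : #((r * s) • A - r • A) = #(A - s • A) := by
    rw [mul_smul, ← smul_finset_sub_distrib, card_smul_finset₀ hr0, ← neg_sub, card_neg]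
  rw [h1, h2] at h
  have hApos : (0 : ℝ) < #A := by exact_mod_cast hA.card_pos
  have h' : (#(A - (r * s) • A) : ℝ) * #A ≤ #(A - r • A) * #(A - s • A) := by exact_mod_cast h
  refine le_of_mul_le_mul_right (h'.trans ?_) hApos
  calc (#(A - r • A) : ℝ) * #(A - s • A) ≤ (M * #A) * (M * #A) := by
        gcongr
        exacts [hr, hs]
    _ = _ := by ring

lemma inv (hr : IsCloseDilate A M r) : IsCloseDilate A M r⁻¹ := by
  rcases eq_or_ne r 0 with rfl | hr0
  · rwa [inv_zero]
  have h2 : #(A - r⁻¹ • A) = #(A - r • A) := by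
    rw [← card_smul_finset₀ hr0 (A - r⁻¹ • A), smul_finset_sub_distrib, smul_smul, mul_inv_cancel₀ hr0, one_smul, ← neg_sub, card_neg]
  rwa [IsCloseDilate, h2]

lemma div (hA : A.Nonempty) (hM : 1 ≤ M) (hr : IsCloseDilate A M r) (hs : IsCloseDilate A M s) :
    IsCloseDilate A (M ^ 2) (r / s) := by
  rw [div_eq_mul_inv]
  exact hr.mul hA hM hs.inv

lemma exists_cover (hA : A.Nonempty) (hr : IsCloseDilate A M r) :
    ∃ T : Finset F, (#T : ℝ) ≤ M ∧ r • A ⊆ T + (A - A) := by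
  have h : (#(r • A + -A) : ℝ) ≤ M * #(-A) := by
    rw [← sub_eq_add_neg, ← neg_sub, card_neg, card_neg]
    exact hr
  obtain ⟨T, -, hT, hcov⟩ := ruzsa_covering_add hA.neg h
  refine ⟨T, hT, hcov.trans_eq ?_⟩
  rw [sub_neg_eq_add, neg_add_eq_sub]

/-- `A - (r + s) • A` is covered by `#T * #U ≤ M ^ 2` translates of `3A - 2A`, whose size
Plünnecke–Ruzsa bounds by `M ^ 5 * #A`. -/
lemma of_cover (hA : A.Nonempty) (hL : (#(A - A) : ℝ) ≤ M * #A) {T U : Finset F}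
    (hT : (#T : ℝ) ≤ M) (hU : (#U : ℝ) ≤ M) (hr : r • A ⊆ T + (A - A)) (hs : s • A ⊆ U + (A - A)) :
    IsCloseDilate A (M ^ 7) (r + s) := by
  have hM : 0 ≤ M := (Nat.cast_nonneg _).trans hT
  have hsub : A - (r + s) • A ⊆ -(T + U) + (A + A + A - (A + A)) := by
    have h1 : (r + s) • A ⊆ (T + (A - A)) + (U + (A - A)) := by
      intro x hx
      obtain ⟨a, ha, rfl⟩ := mem_smul_finset.1 hx
      rw [add_smul]
      exact add_mem_add (hr (smul_mem_smul_finset ha)) (hs (smul_mem_smul_finset ha))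
    refine (sub_subset_sub_left h1).trans_eq ?_
    simp only [sub_eq_add_neg, neg_add, neg_neg]
    ac_rfl
  have hcard : #(A - (r + s) • A) ≤ #T * #U * #(A + A + A - (A + A)) :=
    (card_le_card hsub).trans <| card_add_le.trans <| by
      rw [card_neg]
      gcongr
      exact card_add_le
  calc (#(A - (r + s) • A) : ℝ) ≤ #T * #U * #(A + A + A - (A + A)) := by exact_mod_cast hcard
    _ ≤ M * M * (M ^ 5 * #A) := by
      gcongr
      exact card_add_add_sub_add_le hA hL
    _ = _ := by ring

lemma add (hA : A.Nonempty) (hL : (#(A - A) : ℝ) ≤ M * #A) (hr : IsCloseDilate A M r)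
    (hs : IsCloseDilate A M s) : IsCloseDilate A (M ^ 7) (r + s) := by
  obtain ⟨T, hT, hrT⟩ := hr.exists_cover hA
  obtain ⟨U, hU, hsU⟩ := hs.exists_cover hA
  exact of_cover hA hL hT hU hrT hsU

lemma sub (hA : A.Nonempty) (hL : (#(A - A) : ℝ) ≤ M * #A) (hr : IsCloseDilate A M r)
    (hs : IsCloseDilate A M s) : IsCloseDilate A (M ^ 7) (r - s) := by
  obtain ⟨T, hT, hrT⟩ := hr.exists_cover hA
  obtain ⟨U, hU, hsU⟩ := hs.exists_cover hA
  rw [sub_eq_add_neg]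
  refine of_cover hA hL hT (U := -U) (by rwa [card_neg]) hrT ?_
  have : -(U + (A - A)) = -U + (A - A) := by
    rw [neg_add, neg_sub]
  rw [neg_smul_finset, ← this]
  exact neg_subset_neg hsU

end IsCloseDilate

lemma eq_univ_of_add_one_mem {p : ℕ} [NeZero p] {Q : Set (ZMod p)} (h0 : (0 : ZMod p) ∈ Q)
    (h1 : ∀ q ∈ Q, q + 1 ∈ Q) (x : ZMod p) : x ∈ Q := by
  obtain ⟨n, rfl⟩ := ZMod.natCast_zmod_surjective x
  induction n with
  | zero => simpa using h0
  | succ n ih => simpa using h1 _ ih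

variable {p : ℕ} [Fact p.Prime] {A : Finset (ZMod p)} {M : ℝ}

/-- If the quotient set `Q` of `S` is closed under adding `1`, it is all of the prime field.
Otherwise some `q + 1 ∉ Q`, so `(x, y) ↦ x + (q + 1) * y` is injective on `S ×ˢ S`. Exponents: a sum
or difference costs a factor `7`, a product or quotient `2`, and `1372 = 7 * 2 * 7 * 2 * 7`. -/
lemma isCloseDilate_growth (hA : A.Nonempty) (hM : 1 ≤ M) (hL : (#(A - A) : ℝ) ≤ M * #A)
    {S : Finset (ZMod p)} (hS : S.Nonempty) (hSM : ∀ s ∈ S, IsCloseDilate A M s) :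
    (∀ r, IsCloseDilate A (M ^ 1372) r) ∨
      ∃ S' : Finset (ZMod p), #S' = #S ^ 2 ∧ ∀ s ∈ S', IsCloseDilate A (M ^ 1372) s := by
  let Q : Set (ZMod p) := {q | ∃ a ∈ S, ∃ b ∈ S, ∃ c ∈ S, ∃ d ∈ S, q = (a - b) / (c - d)}
  have hLpow : ∀ n : ℕ, n ≠ 0 → (#(A - A) : ℝ) ≤ M ^ n * #A := fun n hn =>
    hL.trans (by gcongr; exact le_self_pow₀ hM hn)
  have hQ : ∀ q ∈ Q, IsCloseDilate A (M ^ 14) q := by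
    rintro q ⟨a, ha, b, hb, c, hc, d, hd, rfl⟩
    have := ((hSM a ha).sub hA hL (hSM b hb)).div hA (one_le_pow₀ hM)
      ((hSM c hc).sub hA hL (hSM d hd))
    rwa [← pow_mul] at this
  by_cases hcl : ∀ q ∈ Q, q + 1 ∈ Q
  · left
    intro r
    obtain ⟨a, ha⟩ := hS
    -- Here `0 / 0 = 0`; zero denominators contribute only `0` to `Q`.
    have h0 : (0 : ZMod p) ∈ Q := ⟨a, ha, a, ha, a, ha, a, ha, by simp⟩
    exact (hQ r (eq_univ_of_add_one_mem h0 hcl r)).mono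
      (pow_le_pow_right₀ hM (by norm_num))
  · right
    push Not at hcl
    obtain ⟨q, hq, hq1⟩ := hcl
    refine ⟨(S ×ˢ S).image fun x => x.1 + (q + 1) * x.2, ?_, ?_⟩
    · rw [card_image_of_injOn, card_product, sq]
      rintro ⟨x, y⟩ hx ⟨x', y'⟩ hx' h
      simp only [coe_product, Set.mem_prod, mem_coe] at hx hx' h
      have hy : y = y' := by
        by_contra hne
        refine hq1 ⟨x', hx'.1, x, hx.1, y, hx.2, y', hx'.2, ?_⟩
        rw [eq_div_iff (sub_ne_zero.2 hne)]
        linear_combination h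
      subst hy
      simpa using h
    · intro s hs
      obtain ⟨⟨x, y⟩, hxy, rfl⟩ := mem_image.1 hs
      rw [mem_product] at hxy
      have h1 : IsCloseDilate A (M ^ 14) (1 : ZMod p) := by
        rw [IsCloseDilate, one_smul]
        exact hLpow 14 (by norm_num)
      have h2 := (hQ q hq).add hA (hLpow 14 (by norm_num)) h1
      rw [← pow_mul] at h2
      have h3 := h2.mul hA (one_le_pow₀ hM)
        ((hSM y hxy.2).mono (le_self_pow₀ hM (by norm_num : 14 * 7 ≠ 0)))
      rw [← pow_mul] at h3
      have h4 := ((hSM x hxy.1).mono (le_self_pow₀ hM (by norm_num : 14 * 7 * 2 ≠ 0))).add hA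
        (hLpow _ (by norm_num)) h3
      rw [← pow_mul] at h4
      exact h4

/-- Each round squares `#S`, so within `j` rounds the growth alternative would overflow `F_p`. -/
lemma isCloseDilate_of_lt_card_pow (hA : A.Nonempty) (hM : 1 ≤ M)
    (hL : (#(A - A) : ℝ) ≤ M * #A) {S : Finset (ZMod p)} (hSM : ∀ s ∈ S, IsCloseDilate A M s)
    (j : ℕ) (hS : p < #S ^ 2 ^ j) (r : ZMod p) : IsCloseDilate A (M ^ 1372 ^ j) r := by
  induction j generalizing M S with
  | zero =>
    have h := card_le_univ S
    rw [ZMod.card] at h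
    rw [pow_zero, pow_one] at hS
    omega
  | succ j ih =>
    have hSne : S.Nonempty := by
      rw [nonempty_iff_ne_empty]
      rintro rfl
      simp at hS
    rcases isCloseDilate_growth hA hM hL hSne hSM with h | ⟨S', hcard, hS'⟩
    · exact (h r).mono (pow_le_pow_right₀ hM (le_self_pow₀ (by norm_num) (by norm_num)))
    · have := ih (one_le_pow₀ hM) (hL.trans (by gcongr; exact le_self_pow₀ hM (by norm_num))) hS'
        (by rwa [hcard, ← pow_mul, ← pow_succ'])
      rwa [← pow_mul, ← pow_succ'] at this

end RuzsaCalculus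

/-! ### Not every dilate of a set of intermediate size is close to it. -/

section Dilates

lemma card_sq_le_card_mul_card_eq {α β : Type*} [DecidableEq β] {D : Finset α} {U : Finset β}
    {f : α → β} (hf : ∀ x ∈ D, f x ∈ U) :
    #D ^ 2 ≤ #U * #{x ∈ D ×ˢ D | f x.1 = f x.2} := by
  have h1 : #{x ∈ D ×ˢ D | f x.1 = f x.2} = ∑ u ∈ U, #{x ∈ D | f x = u} ^ 2 := by
    rw [card_eq_sum_card_fiberwise (f := fun x => f x.1) (t := U)]
    · refine sum_congr rfl fun u _ => ?_
      rw [sq, ← card_product]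
      congr 1
      ext x
      simp only [mem_filter, mem_product]
      constructor
      · rintro ⟨⟨⟨h1, h2⟩, h3⟩, h4⟩
        exact ⟨⟨h1, h4⟩, h2, h3 ▸ h4⟩
      · rintro ⟨⟨h1, h2⟩, h3, h4⟩
        exact ⟨⟨⟨h1, h3⟩, h2.trans h4.symm⟩, h2⟩
    · intro x hx
      simp only [coe_filter, mem_product, Set.mem_ofPred_eq] at hx
      exact hf _ hx.1.1
  rw [h1, card_eq_sum_card_fiberwise hf]
  exact sq_sum_le_card_mul_sum_sq

variable {F : Type*} [Field F] [Fintype F] [DecidableEq F]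

/-- A quadruple with `b ≠ b'` determines `r`; only the diagonal ones survive for every `r`. -/
lemma sum_card_dilate_energy_le (A : Finset F) :
    ∑ r : F, #{x ∈ (A ×ˢ A) ×ˢ (A ×ˢ A) | x.1.1 - r * x.1.2 = x.2.1 - r * x.2.2}
      ≤ #A ^ 4 + Fintype.card F * #A ^ 2 := by
  simp_rw [card_filter]
  rw [sum_comm]
  have h : ∀ x ∈ (A ×ˢ A) ×ˢ (A ×ˢ A),
      ∑ r : F, (if x.1.1 - r * x.1.2 = x.2.1 - r * x.2.2 then 1 else 0)
        ≤ 1 + if x.1 = x.2 then Fintype.card F else 0 := by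
    rintro ⟨⟨a, b⟩, ⟨a', b'⟩⟩ -
    rw [← card_filter]
    by_cases hb : b = b'
    · subst hb
      by_cases ha : a = a'
      · subst ha
        simp
      · simp [ha]
    · refine le_trans ?_ (Nat.le_add_right _ _)
      refine card_le_one.2 fun r hr s hs => ?_
      simp only [mem_filter, mem_univ, true_and] at hr hs
      refine mul_right_cancel₀ (sub_ne_zero.2 hb) ?_
      linear_combination hs - hr
  refine (sum_le_sum h).trans ?_
  rw [sum_add_distrib, ← sum_filter, sum_const, sum_const, smul_eq_mul, smul_eq_mul, mul_one,
    card_product, card_product]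
  have : #{x ∈ (A ×ˢ A) ×ˢ (A ×ˢ A) | x.1 = x.2} = #A ^ 2 := by
    rw [show #A ^ 2 = #(A ×ˢ A).diag by rw [diag_card, card_product, sq]]
    congr 1
    ext x
    simp only [mem_filter, mem_product, mem_diag]
    constructor
    · rintro ⟨h1, h2⟩
      exact ⟨h1.1, h2⟩
    · rintro ⟨h1, h2⟩
      exact ⟨⟨h1, h2 ▸ h1⟩, h2⟩
  rw [this]
  apply le_of_eq
  ring

/-- Cauchy–Schwarz turns a small `A - r • A` into a large dilate energy; summing over `r` meets the
upper bound of `sum_card_dilate_energy_le`. -/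
lemma card_mul_card_le_of_forall_isCloseDilate {A : Finset F} (hA : A.Nonempty) {M : ℝ}
    (h : ∀ r, IsCloseDilate A M r) :
    (Fintype.card F : ℝ) * #A ≤ M * (#A ^ 2 + Fintype.card F) := by
  have hApos : (0 : ℝ) < #A := by exact_mod_cast hA.card_pos
  have hM : 0 ≤ M := by
    have := (Nat.cast_nonneg _).trans (h 0)
    exact nonneg_of_mul_nonneg_left this hApos
  have h1 : ∀ r : F, (#A : ℝ) ^ 4 ≤ M * #A *
      #{x ∈ (A ×ˢ A) ×ˢ (A ×ˢ A) | x.1.1 - r * x.1.2 = x.2.1 - r * x.2.2} := by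
    intro r
    have := card_sq_le_card_mul_card_eq (D := A ×ˢ A) (U := A - r • A)
      (f := fun x => x.1 - r * x.2) fun x hx =>
        sub_mem_sub (mem_product.1 hx).1 (smul_mem_smul_finset (mem_product.1 hx).2)
    calc (#A : ℝ) ^ 4 = (#(A ×ˢ A) : ℝ) ^ 2 := by rw [card_product]; push_cast; ring
      _ ≤ (#(A - r • A) : ℝ) * #{x ∈ (A ×ˢ A) ×ˢ (A ×ˢ A) | x.1.1 - r * x.1.2 = x.2.1 - r * x.2.2} := by
        exact_mod_cast this
      _ ≤ _ := by
        gcongr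
        exact h r
  have h2 : (Fintype.card F : ℝ) * #A ^ 4 ≤ M * #A * (#A ^ 4 + Fintype.card F * #A ^ 2) := by
    calc (Fintype.card F : ℝ) * #A ^ 4 = ∑ r : F, (#A : ℝ) ^ 4 := by simp
      _ ≤ _ := sum_le_sum fun r _ => h1 r
      _ = M * #A * ((∑ r : F,
          #{x ∈ (A ×ˢ A) ×ˢ (A ×ˢ A) | x.1.1 - r * x.1.2 = x.2.1 - r * x.2.2} : ℕ) : ℝ) := by
        rw [← mul_sum]
        push_cast
        rfl
      _ ≤ _ := by
        gcongr
        exact_mod_cast sum_card_dilate_energy_le A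
  refine le_of_mul_le_mul_right ?_ (pow_pos hApos 3)
  linarith

end Dilates

/-! ### Dense subsets of sets invariant under `H`. -/

section InvariantSets

variable {F : Type*} [Field F] [DecidableEq F]

/-- Cauchy–Schwarz over `X` for the number `g x` of `h ∈ H` with `h * x ∈ A`. -/
lemma card_mul_card_sq_le_of_invariant (H : Subgroup Fˣ) [Fintype H] {X A : Finset F}
    (hAX : A ⊆ X) (hX : ∀ h ∈ H, ∀ x ∈ X, (h : F) * x ∈ X) :
    Fintype.card H * #A ^ 2 ≤ #X * ∑ h : H, #{y ∈ A | ((h : Fˣ) : F) * y ∈ A} := by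
  let g : F → ℕ := fun x => ∑ h : H, if ((h : Fˣ) : F) * x ∈ A then 1 else 0
  have h1 : ∑ x ∈ X, g x = Fintype.card H * #A := by
    simp only [g]
    rw [sum_comm]
    have : ∀ h : H, ∑ x ∈ X, (if ((h : Fˣ) : F) * x ∈ A then 1 else 0) = #A := by
      intro h
      rw [← card_filter]
      refine card_nbij' (fun x => ((h : Fˣ) : F) * x) (fun x => ((h⁻¹ : H) : Fˣ) * x) ?_ ?_ ?_ ?_
      · intro x hx
        exact (mem_filter.1 hx).2
      · intro x hx
        refine mem_filter.2 ⟨hX _ (h⁻¹).2 x (hAX hx), ?_⟩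
        simpa using hx
      · intro x _
        simp
      · intro x _
        simp
    simp [this]
  have h2 : ∑ x ∈ X, g x ^ 2
      = Fintype.card H * ∑ h : H, #{y ∈ A | ((h : Fˣ) : F) * y ∈ A} := by
    have e1 : ∀ x, g x ^ 2 = ∑ h : H, ∑ k : H,
        if ((h : Fˣ) : F) * x ∈ A ∧ ((k : Fˣ) : F) * x ∈ A then 1 else 0 := by
      intro x
      simp only [g]
      rw [sq, sum_mul_sum]
      simp_rw [ite_zero_mul_ite_zero, mul_one]
    simp_rw [e1]
    rw [sum_comm (s := X)]
    have e2 : ∀ h : H, ∑ x ∈ X, ∑ k : H,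
        (if ((h : Fˣ) : F) * x ∈ A ∧ ((k : Fˣ) : F) * x ∈ A then 1 else 0)
          = ∑ h : H, #{y ∈ A | ((h : Fˣ) : F) * y ∈ A} := by
      intro h
      rw [sum_comm, ← Equiv.sum_comp (Equiv.mulRight h)]
      refine sum_congr rfl fun k _ => ?_
      rw [← card_filter]
      refine card_nbij' (fun x => ((h : Fˣ) : F) * x) (fun x => ((h⁻¹ : H) : Fˣ) * x) ?_ ?_ ?_ ?_
      · intro x hx
        have := (mem_filter.1 hx).2
        refine mem_filter.2 ⟨this.1, ?_⟩
        simpa [mul_assoc] using this.2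
      · intro x hx
        obtain ⟨hx1, hx2⟩ := mem_filter.1 hx
        refine mem_filter.2 ⟨hX _ (h⁻¹).2 x (hAX hx1), ?_⟩
        simpa [mul_assoc] using And.intro hx1 hx2
      · intro x _
        simp
      · intro x _
        simp
    rw [sum_congr rfl fun h _ => e2 h, sum_const, card_univ, smul_eq_mul]
  have h3 : (∑ x ∈ X, g x) ^ 2 ≤ #X * ∑ x ∈ X, g x ^ 2 := sq_sum_le_card_mul_sum_sq
  rw [h1, h2] at h3
  refine Nat.le_of_mul_le_mul_left ?_ (Fintype.card_pos : 0 < Fintype.card H)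
  calc Fintype.card H * (Fintype.card H * #A ^ 2) = (Fintype.card H * #A) ^ 2 := by ring
    _ ≤ _ := h3
    _ = _ := by ring

/-- Ruzsa's triangle inequality through `h • D`, which lies in both `A` and `h • A`. -/
lemma isCloseDilate_of_card_le {A : Finset F} (hA : A.Nonempty) {L c : ℝ}
    (hL : (#(A - A) : ℝ) ≤ L * #A) {h : F} (hh : h ≠ 0)
    (hc : (#A : ℝ) ≤ c * #{y ∈ A | h * y ∈ A}) : IsCloseDilate A (c * L ^ 2) h := by
  set D := {y ∈ A | h * y ∈ A} with hD
  have hDA : h • D ⊆ A := by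
    intro x hx
    obtain ⟨y, hy, rfl⟩ := mem_smul_finset.1 hx
    exact (mem_filter.1 hy).2
  have h1 := ruzsa_triangle_inequality_sub_sub_sub A (h • D) (h • A)
  have h2 : #(A - h • D) ≤ #(A - A) := card_le_card (sub_subset_sub_left hDA)
  have h3 : #(h • A - h • D) ≤ #(A - A) := by
    rw [← smul_finset_sub_distrib, card_smul_finset₀ hh]
    exact card_le_card (sub_subset_sub_left (filter_subset _ _))
  rw [card_smul_finset₀ hh] at h1
  have h4 : (#(A - h • A) : ℝ) * #D ≤ (L * #A) * (L * #A) := by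
    calc (#(A - h • A) : ℝ) * #D ≤ #(A - A) * #(A - A) := by
          exact_mod_cast h1.trans (Nat.mul_le_mul h2 h3)
      _ ≤ _ := mul_le_mul hL hL (Nat.cast_nonneg _) ((Nat.cast_nonneg _).trans hL)
  have hApos : (0 : ℝ) < #A := by exact_mod_cast hA.card_pos
  have hDpos : (0 : ℝ) < #D := by
    rcases (Nat.cast_nonneg (α := ℝ) #D).eq_or_lt with h0 | h0
    · rw [← h0, mul_zero] at hc
      linarith
    · exact h0
  have hc0 : 0 ≤ c := (pos_of_mul_pos_left (hApos.trans_le hc) hDpos.le).le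
  refine le_of_mul_le_mul_right ?_ hApos
  calc (#(A - h • A) : ℝ) * #A ≤ #(A - h • A) * (c * #D) := by gcongr
    _ = c * (#(A - h • A) * #D) := by ring
    _ ≤ c * ((L * #A) * (L * #A)) := by gcongr
    _ = _ := by ring

/-- If a subset `A` of small doubling is dense in an `H`-invariant set, then many elements of `H`
dilate `A` to a set close to `A`. -/
lemma exists_many_isCloseDilate (H : Subgroup Fˣ) [Fintype H] {X A : Finset F}
    (hA : A.Nonempty) (hAX : A ⊆ X) (hX : ∀ h ∈ H, ∀ x ∈ X, (h : F) * x ∈ X) {K L : ℝ}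
    (hK : 0 < K) (hXA : (#X : ℝ) ≤ K * #A) (hL : (#(A - A) : ℝ) ≤ L * #A) :
    ∃ S : Finset F, (Fintype.card H : ℝ) ≤ 2 * K * #S ∧
      ∀ s ∈ S, IsCloseDilate A (2 * K * L ^ 2) s := by
  classical
  let c : H → ℕ := fun h => #{y ∈ A | ((h : Fˣ) : F) * y ∈ A}
  let T : Finset H := {h | (#A : ℝ) ≤ 2 * K * c h}
  have hApos : (0 : ℝ) < #A := by exact_mod_cast hA.card_pos
  have h1 : (Fintype.card H : ℝ) * #A ≤ K * ∑ h : H, (c h : ℝ) := by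
    have h0 : (Fintype.card H : ℝ) * #A ^ 2 ≤ #X * ∑ h : H, (c h : ℝ) := by
      exact_mod_cast card_mul_card_sq_le_of_invariant H hAX hX
    refine le_of_mul_le_mul_right ?_ hApos
    calc (Fintype.card H : ℝ) * #A * #A = Fintype.card H * #A ^ 2 := by ring
      _ ≤ _ := h0
      _ ≤ (K * #A) * ∑ h : H, (c h : ℝ) := by
        gcongr
      _ = _ := by ring
  have h2 : 2 * K * ∑ h : H, (c h : ℝ) ≤ 2 * K * (#T * #A) + Fintype.card H * #A := by
    have h3 : ∀ h : H, 2 * K * (c h : ℝ) ≤ (if h ∈ T then 2 * K * #A else 0) + #A := by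
      intro h
      split_ifs with hT
      · have : (c h : ℝ) ≤ #A := by exact_mod_cast card_filter_le _ _
        have := mul_le_mul_of_nonneg_left this (by positivity : 0 ≤ 2 * K)
        linarith
      · simp only [T, mem_filter, mem_univ, true_and, not_le] at hT
        linarith
    rw [mul_sum]
    refine (sum_le_sum fun h _ => h3 h).trans_eq ?_
    rw [sum_add_distrib, sum_ite_mem, univ_inter]
    simp
    ring
  refine ⟨T.image fun h : H => ((h : Fˣ) : F), ?_, ?_⟩
  · rw [card_image_of_injective T fun h k hhk => Subtype.ext (Units.ext hhk)]
    refine le_of_mul_le_mul_right ?_ hApos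
    linarith
  · intro s hs
    obtain ⟨h, hh, rfl⟩ := mem_image.1 hs
    exact isCloseDilate_of_card_le hA hL (Units.ne_zero _) (mem_filter.1 hh).2

end InvariantSets

/-! ### The large spectrum of a multiplicative subgroup. -/

section Spectrum

lemma sum_sum_sub_eq {G : Type*} [AddCommGroup G] [Fintype G] [DecidableEq G] (A : Finset G)
    (g : G → ℝ) :
    ∑ x ∈ A, ∑ y ∈ A, g (x - y) = ∑ d, (#(selfInterShift A d) : ℝ) * g d := by
  have h : ∀ x, ∑ y ∈ A, g (x - y) = ∑ d : G, (if x - d ∈ A then (1 : ℝ) else 0) * g d := by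
    intro x
    rw [← (Equiv.subLeft x).sum_comp]
    simp [ite_mul]
  simp_rw [h, card_selfInterShift_eq_sum, sum_mul]
  exact sum_comm

variable {F : Type*} [Field F]

/-- The exponential sum of the character `x ↦ ψ (ξ * x)` over the multiplicative subgroup `H`. -/
noncomputable def subgroupSum (ψ : AddChar F ℂ) (H : Subgroup Fˣ) [Fintype H] (ξ : F) : ℂ :=
  ∑ x : H, ψ (ξ * ((x : Fˣ) : F))

variable (ψ : AddChar F ℂ) (H : Subgroup Fˣ) [Fintype H]

lemma subgroupSum_mul {h : Fˣ} (hh : h ∈ H) (ξ : F) :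
    subgroupSum ψ H (h * ξ) = subgroupSum ψ H ξ := by
  rw [subgroupSum, subgroupSum,
    ← Equiv.sum_comp (Equiv.mulLeft (⟨h, hh⟩ : H)) fun x : H => ψ (ξ * ((x : Fˣ) : F))]
  refine sum_congr rfl fun x _ => ?_
  congr 1
  simp
  ring

variable [Fintype F]

lemma norm_subgroupSum_le (ξ : F) : ‖subgroupSum ψ H ξ‖ ≤ Fintype.card H := by
  refine (norm_sum_le _ _).trans ?_
  simp

lemma sum_norm_sq_subgroupSum [DecidableEq F] {ψ : AddChar F ℂ} (hψ : ψ.IsPrimitive) :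
    ∑ ξ : F, ‖subgroupSum ψ H ξ‖ ^ 2 = Fintype.card F * Fintype.card H := by
  have h1 : ∀ ξ : F, ((‖subgroupSum ψ H ξ‖ ^ 2 : ℝ) : ℂ)
      = ∑ x : H, ∑ y : H, ψ (ξ * (((x : Fˣ) : F) - ((y : Fˣ) : F))) := by
    intro ξ
    push_cast
    rw [← Complex.mul_conj', subgroupSum, map_sum, sum_mul_sum]
    refine sum_congr rfl fun x _ => sum_congr rfl fun y _ => ?_
    rw [← AddChar.map_neg_eq_conj, ← AddChar.map_add_eq_mul]
    congr 1
    ring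
  have h2 : ((∑ ξ : F, ‖subgroupSum ψ H ξ‖ ^ 2 : ℝ) : ℂ) = Fintype.card F * Fintype.card H := by
    push_cast at h1 ⊢
    simp_rw [h1]
    rw [sum_comm]
    have h3 : ∀ x : H, ∑ ξ : F, ∑ y : H, ψ (ξ * (((x : Fˣ) : F) - ((y : Fˣ) : F)))
        = Fintype.card F := by
      intro x
      rw [sum_comm]
      simp_rw [AddChar.sum_mulShift _ hψ, sub_eq_zero, Units.val_inj, Subtype.coe_inj]
      simp
    simp_rw [h3]
    simp
    ring
  exact_mod_cast h2

open Classical in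
/-- The frequencies at which the exponential sum over `H` loses at most a factor `s`. -/
noncomputable def largeSpectrum (s : ℝ) : Finset F :=
  {ξ | (Fintype.card H : ℝ) ≤ s * ‖subgroupSum ψ H ξ‖}

lemma mem_largeSpectrum {s : ℝ} {ξ : F} :
    ξ ∈ largeSpectrum ψ H s ↔ (Fintype.card H : ℝ) ≤ s * ‖subgroupSum ψ H ξ‖ := by
  simp [largeSpectrum]

lemma mul_mem_largeSpectrum {s : ℝ} {h : Fˣ} (hh : h ∈ H) {ξ : F}
    (hξ : ξ ∈ largeSpectrum ψ H s) : (h : F) * ξ ∈ largeSpectrum ψ H s := by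
  rw [mem_largeSpectrum] at hξ ⊢
  rwa [subgroupSum_mul ψ H hh]

lemma card_le_card_largeSpectrum {s : ℝ} {ξ : F} (hξ0 : ξ ≠ 0) (hξ : ξ ∈ largeSpectrum ψ H s) :
    Fintype.card H ≤ #(largeSpectrum ψ H s) := by
  rw [← card_univ]
  refine card_le_card_of_injOn (fun h : H => ((h : Fˣ) : F) * ξ) ?_ ?_
  · intro h _
    exact mul_mem_largeSpectrum ψ H h.2 hξ
  · intro h _ k _ hhk
    exact Subtype.ext (Units.ext (mul_right_cancel₀ hξ0 hhk))

/-- Parseval and Chebyshev. -/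
lemma card_largeSpectrum_mul_le {ψ : AddChar F ℂ} (hψ : ψ.IsPrimitive) (s : ℝ) :
    (#(largeSpectrum ψ H s) : ℝ) * Fintype.card H ≤ s ^ 2 * Fintype.card F := by
  classical
  have hH : (0 : ℝ) < Fintype.card H := by exact_mod_cast Fintype.card_pos
  refine le_of_mul_le_mul_right ?_ hH
  calc (#(largeSpectrum ψ H s) : ℝ) * Fintype.card H * Fintype.card H
      = #(largeSpectrum ψ H s) • (Fintype.card H : ℝ) ^ 2 := by rw [nsmul_eq_mul]; ring
    _ ≤ ∑ ξ ∈ largeSpectrum ψ H s, s ^ 2 * ‖subgroupSum ψ H ξ‖ ^ 2 := by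
      refine card_nsmul_le_sum _ _ _ fun ξ hξ => ?_
      rw [← mul_pow]
      exact pow_le_pow_left₀ hH.le ((mem_largeSpectrum ψ H).1 hξ) 2
    _ ≤ ∑ ξ : F, s ^ 2 * ‖subgroupSum ψ H ξ‖ ^ 2 :=
      sum_le_sum_of_subset_of_nonneg (subset_univ _) fun _ _ _ => by positivity
    _ = _ := by
      rw [← mul_sum, sum_norm_sq_subgroupSum H hψ]
      ring

/-- Unimodular phases turn the sum of `‖subgroupSum ψ H ξ‖` over the spectrum into a sum over `x ∈
H`; Cauchy–Schwarz in `x` then brings out the differences `ξ - η`. -/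
lemma card_mul_card_sq_le_sum_norm {s : ℝ} (hs : 0 < s) :
    (Fintype.card H : ℝ) * #(largeSpectrum ψ H s) ^ 2 ≤ s ^ 2 *
      ∑ ξ ∈ largeSpectrum ψ H s, ∑ η ∈ largeSpectrum ψ H s, ‖subgroupSum ψ H (ξ - η)‖ := by
  set X := largeSpectrum ψ H s with hX
  have hH : (0 : ℝ) < Fintype.card H := by exact_mod_cast Fintype.card_pos
  let c : F → ℂ := fun ξ => conj (subgroupSum ψ H ξ) / ‖subgroupSum ψ H ξ‖
  have hc : ∀ ξ, ‖c ξ‖ ≤ 1 := fun ξ => by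
    simp only [c, norm_div, RCLike.norm_conj, Complex.norm_real, norm_norm]
    exact div_self_le_one _
  have hcS : ∀ ξ, c ξ * subgroupSum ψ H ξ = ‖subgroupSum ψ H ξ‖ := fun ξ => by
    rcases eq_or_ne (subgroupSum ψ H ξ) 0 with h | h
    · simp [h]
    · have : (‖subgroupSum ψ H ξ‖ : ℂ) ≠ 0 := by simpa using h
      simp only [c]
      rw [div_mul_eq_mul_div, mul_comm, Complex.mul_conj', sq, mul_div_cancel_right₀ _ this]
  let T : H → ℂ := fun x => ∑ ξ ∈ X, c ξ * ψ (ξ * ((x : Fˣ) : F))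
  have h1 : (Fintype.card H : ℝ) * #X ≤ s * ∑ x : H, ‖T x‖ := by
    have e1 : ((∑ ξ ∈ X, ‖subgroupSum ψ H ξ‖ : ℝ) : ℂ) = ∑ x : H, T x := by
      push_cast
      simp_rw [← hcS, T, subgroupSum, mul_sum]
      exact sum_comm
    have e2 : ∑ ξ ∈ X, ‖subgroupSum ψ H ξ‖ ≤ ∑ x : H, ‖T x‖ := by
      refine le_trans ?_ (norm_sum_le _ _)
      rw [← e1, Complex.norm_real]
      exact le_abs_self _
    calc (Fintype.card H : ℝ) * #X = #X • (Fintype.card H : ℝ) := by rw [nsmul_eq_mul, mul_comm]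
      _ ≤ ∑ ξ ∈ X, s * ‖subgroupSum ψ H ξ‖ :=
        card_nsmul_le_sum _ _ _ fun ξ hξ => (mem_largeSpectrum ψ H).1 hξ
      _ ≤ _ := by
        rw [← mul_sum]
        gcongr
  have h2 : (∑ x : H, ‖T x‖) ^ 2 ≤ Fintype.card H * ∑ x : H, ‖T x‖ ^ 2 := by
    simpa using sq_sum_le_card_mul_sum_sq (s := (univ : Finset H)) (f := fun x => ‖T x‖)
  have h3 : ∑ x : H, ‖T x‖ ^ 2 ≤ ∑ ξ ∈ X, ∑ η ∈ X, ‖subgroupSum ψ H (ξ - η)‖ := by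
    have e1 : ((∑ x : H, ‖T x‖ ^ 2 : ℝ) : ℂ)
        = ∑ ξ ∈ X, ∑ η ∈ X, c ξ * conj (c η) * subgroupSum ψ H (ξ - η) := by
      have e2 : ∀ x : H, ((‖T x‖ : ℂ) ^ 2) = ∑ ξ ∈ X, ∑ η ∈ X,
          c ξ * conj (c η) * ψ ((ξ - η) * ((x : Fˣ) : F)) := by
        intro x
        rw [← Complex.mul_conj']
        simp only [T]
        rw [map_sum, sum_mul_sum]
        refine sum_congr rfl fun ξ _ => sum_congr rfl fun η _ => ?_
        rw [map_mul (starRingEnd ℂ), ← AddChar.map_neg_eq_conj, sub_mul, sub_eq_add_neg, AddChar.map_add_eq_mul]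
        ring
      push_cast
      simp_rw [e2, subgroupSum, mul_sum]
      rw [sum_comm]
      exact sum_congr rfl fun ξ _ => sum_comm
    have e3 : ∑ x : H, ‖T x‖ ^ 2 = ‖((∑ x : H, ‖T x‖ ^ 2 : ℝ) : ℂ)‖ := by
      rw [Complex.norm_real, Real.norm_of_nonneg (sum_nonneg fun _ _ => by positivity)]
    rw [e3, e1]
    refine (norm_sum_le _ _).trans (sum_le_sum fun ξ _ => (norm_sum_le _ _).trans
      (sum_le_sum fun η _ => ?_))
    rw [norm_mul, norm_mul, RCLike.norm_conj]
    exact mul_le_of_le_one_left (norm_nonneg _)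
      (mul_le_one₀ (hc ξ) (norm_nonneg _) (hc η))
  refine le_of_mul_le_mul_left ?_ hH
  calc (Fintype.card H : ℝ) * (Fintype.card H * #X ^ 2) = (Fintype.card H * #X) ^ 2 := by ring
    _ ≤ (s * ∑ x : H, ‖T x‖) ^ 2 := pow_le_pow_left₀ (by positivity) h1 2
    _ = s ^ 2 * (∑ x : H, ‖T x‖) ^ 2 := by ring
    _ ≤ s ^ 2 * (Fintype.card H * ∑ ξ ∈ X, ∑ η ∈ X, ‖subgroupSum ψ H (ξ - η)‖) := by
      gcongr
      exact h2.trans (by gcongr)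
    _ = _ := by ring

/-- The large spectrum has large additive energy unless it grows when the threshold is lowered. -/
lemma largeSpectrum_energy [DecidableEq F] {s q : ℝ} (hs : 0 < s)
    (hq : (#(largeSpectrum ψ H (2 * s ^ 2)) : ℝ) ≤ q * #(largeSpectrum ψ H s)) :
    (#(largeSpectrum ψ H s) : ℝ) ^ 3
      ≤ 4 * s ^ 4 * q * ∑ d : F, (#(selfInterShift (largeSpectrum ψ H s) d) : ℝ) ^ 2 := by
  have h0 := card_mul_card_sq_le_sum_norm ψ H hs
  set X := largeSpectrum ψ H s with hX
  set Y := largeSpectrum ψ H (2 * s ^ 2) with hY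
  have hH : (0 : ℝ) < Fintype.card H := by exact_mod_cast Fintype.card_pos
  rw [sum_sum_sub_eq X (fun d => ‖subgroupSum ψ H d‖), mul_sum] at h0
  let r : F → ℝ := fun d => #(selfInterShift X d)
  -- Differences outside `Y` account for at most half of the lower bound `h0`; this fixes the
  -- threshold `2 * s ^ 2`.
  have h1 : ∀ d, s ^ 2 * (r d * ‖subgroupSum ψ H d‖)
      ≤ s ^ 2 * Fintype.card H * (if d ∈ Y then r d else 0) + Fintype.card H / 2 * r d := by
    intro d
    have hr : 0 ≤ r d := Nat.cast_nonneg _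
    split_ifs with hd
    · have := mul_le_mul_of_nonneg_left (norm_subgroupSum_le ψ H d)
        (mul_nonneg (sq_nonneg s) hr)
      have : 0 ≤ Fintype.card H / 2 * r d := by positivity
      linarith
    · rw [hY, mem_largeSpectrum, not_le] at hd
      have := mul_le_mul_of_nonneg_left hd.le hr
      linarith
  have h2 : (#X : ℝ) ^ 2 ≤ 2 * s ^ 2 * ∑ d ∈ Y, r d := by
    have h3 := h0.trans (sum_le_sum fun d _ => h1 d)
    rw [sum_add_distrib, ← mul_sum, ← mul_sum, sum_ite_mem, univ_inter,
      sum_card_selfInterShift] at h3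
    refine le_of_mul_le_mul_left ?_ hH
    linarith
  have h4 : (∑ d ∈ Y, r d) ^ 2 ≤ #Y * ∑ d, r d ^ 2 :=
    sq_sum_le_card_mul_sum_sq.trans <| by
      gcongr
      exact subset_univ _
  have hE : 0 ≤ ∑ d, r d ^ 2 := sum_nonneg fun _ _ => sq_nonneg _
  rcases X.eq_empty_or_nonempty with hX0 | hXne
  · have hz : ∀ d, #(selfInterShift X d) = 0 := fun d => by
      rw [hX0, selfInterShift, filter_empty, card_empty]
    simp_rw [hz]
    simp [hX0]
  have hXpos : (0 : ℝ) < #X := by exact_mod_cast hXne.card_pos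
  refine le_of_mul_le_mul_right ?_ hXpos
  calc (#X : ℝ) ^ 3 * #X = ((#X : ℝ) ^ 2) ^ 2 := by ring
    _ ≤ (2 * s ^ 2 * ∑ d ∈ Y, r d) ^ 2 := pow_le_pow_left₀ (by positivity) h2 2
    _ = 4 * s ^ 4 * (∑ d ∈ Y, r d) ^ 2 := by ring
    _ ≤ 4 * s ^ 4 * ((q * #X) * ∑ d, r d ^ 2) :=
      mul_le_mul_of_nonneg_left (h4.trans (mul_le_mul_of_nonneg_right hq hE)) (by positivity)
    _ = 4 * s ^ 4 * q * (∑ d, r d ^ 2) * #X := by ring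

end Spectrum

/-! ### Growth of the large spectrum as the threshold is lowered. -/

section SubgroupSums

variable {p : ℕ} [Fact p.Prime] {ψ : AddChar (ZMod p) ℂ} (H : Subgroup (ZMod p)ˣ) [Fintype H]

/-- For a subgroup of size a power of `p`, the large spectrum grows by a power of `p` whenever the
threshold is lowered. -/
lemma mul_card_largeSpectrum_lt (hψ : ψ.IsPrimitive) {n e : ℕ} (hn : 1 ≤ n)
    (he : e = 57 * 1372 ^ (2 * n + 1)) {q : ℝ} (hq : 2 ^ 27 ≤ q)
    (hp : (p : ℝ) = q ^ (n * (e + 10))) (hH : q ^ (e + 10) ≤ (Fintype.card H : ℝ)) {s : ℝ}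
    (hs : 0 < s) (hsq : s ≤ q) {ξ : ZMod p} (hξ0 : ξ ≠ 0) (hξ : ξ ∈ largeSpectrum ψ H s) :
    q * #(largeSpectrum ψ H s) < #(largeSpectrum ψ H (2 * s ^ 2)) := by
  by_contra! hcon
  have hq1 : 1 ≤ q := by linarith
  have hq0 : 0 < q := by linarith
  have hE := largeSpectrum_energy ψ H hs hcon
  have hHX : (Fintype.card H : ℝ) ≤ #(largeSpectrum ψ H s) := by
    exact_mod_cast card_le_card_largeSpectrum ψ H hξ0 hξ
  have hXH := card_largeSpectrum_mul_le H hψ s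
  rw [ZMod.card] at hXH
  have hinv : ∀ h ∈ H, ∀ x ∈ largeSpectrum ψ H s, (h : ZMod p) * x ∈ largeSpectrum ψ H s :=
    fun h hh x hx => mul_mem_largeSpectrum ψ H hh hx
  have hXne : (largeSpectrum ψ H s).Nonempty := ⟨ξ, hξ⟩
  generalize largeSpectrum ψ H s = X at *
  have hK : 4 * s ^ 4 * q ≤ q ^ 6 := by
    calc 4 * s ^ 4 * q ≤ q * q ^ 4 * q := by
          gcongr
          linarith
      _ = q ^ 6 := by ring
  obtain ⟨A, hAX, hXA, hAA⟩ := exists_subset_card_sub_le_of_energy hXne (pow_pos hq0 6)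
    (hE.trans (mul_le_mul_of_nonneg_right hK (sum_nonneg fun _ _ => sq_nonneg _)))
  have hHpos : (0 : ℝ) < Fintype.card H := by exact_mod_cast Fintype.card_pos
  have hApos : (0 : ℝ) < #A :=
    pos_of_mul_pos_right (hHpos.trans_le (hHX.trans hXA)) (by positivity)
  have hA : A.Nonempty := by
    rw [← card_pos]
    exact_mod_cast hApos
  have hAA' : (#(A - A) : ℝ) ≤ q ^ 25 * #A := by
    refine hAA.trans ?_
    gcongr
    calc 2 ^ 14 * (q ^ 6) ^ 4 ≤ q * (q ^ 6) ^ 4 := by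
          gcongr
          linarith
      _ = q ^ 25 := by ring
  obtain ⟨S, hHS, hS⟩ := exists_many_isCloseDilate H hA hAX hinv
    (by positivity : 0 < 4 * q ^ 6) hXA hAA'
  have hS' : ∀ r ∈ S, IsCloseDilate A (q ^ 57) r := fun r hr => (hS r hr).mono <| by
    calc 2 * (4 * q ^ 6) * (q ^ 25) ^ 2 = 8 * q ^ 56 := by ring
      _ ≤ q * q ^ 56 := by
        gcongr
        linarith
      _ = q ^ 57 := by ring
  have hq7 : 8 * q ^ 6 ≤ q ^ 7 := by
    calc 8 * q ^ 6 ≤ q * q ^ 6 := by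
          gcongr
          linarith
      _ = q ^ 7 := by ring
  have hScard : q ^ (e + 3) ≤ #S := by
    refine le_of_mul_le_mul_left ?_ (pow_pos hq0 7)
    calc q ^ 7 * q ^ (e + 3) = q ^ (e + 10) := by ring
      _ ≤ 2 * (4 * q ^ 6) * #S := hH.trans hHS
      _ = 8 * q ^ 6 * #S := by ring
      _ ≤ q ^ 7 * #S := by gcongr
  have hAcard : q ^ (e + 3) ≤ #A := by
    refine le_of_mul_le_mul_left ?_ (pow_pos hq0 7)
    calc q ^ 7 * q ^ (e + 3) = q ^ (e + 10) := by ring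
      _ ≤ 4 * q ^ 6 * #A := hH.trans (hHX.trans hXA)
      _ ≤ 8 * q ^ 6 * #A := by
        gcongr
        norm_num
      _ ≤ q ^ 7 * #A := by gcongr
  have hpS : p < #S ^ 2 ^ (2 * n + 1) := by
    have he10 : 10 ≤ e := by
      rw [he]
      have : 1 ≤ 1372 ^ (2 * n + 1) := Nat.one_le_pow _ _ (by norm_num)
      omega
    have hexp : n * (e + 10) < (e + 3) * 2 ^ (2 * n + 1) := by
      have : 2 * n + 1 < 2 ^ (2 * n + 1) := Nat.lt_two_pow_self
      nlinarith
    have : (p : ℝ) < (#S : ℝ) ^ 2 ^ (2 * n + 1) := by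
      calc (p : ℝ) = q ^ (n * (e + 10)) := hp
        _ < q ^ ((e + 3) * 2 ^ (2 * n + 1)) := pow_lt_pow_right₀ (by linarith) hexp
        _ = (q ^ (e + 3)) ^ 2 ^ (2 * n + 1) := pow_mul _ _ _
        _ ≤ _ := pow_le_pow_left₀ (by positivity) hScard _
    exact_mod_cast this
  -- After `2 * n + 1` rounds the loss `q ^ 57` becomes `q ^ e`, which is how `e` was chosen.
  have hall := isCloseDilate_of_lt_card_pow hA (one_le_pow₀ hq1)
    (hAA'.trans (by gcongr; norm_num)) hS' (2 * n + 1) hpS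
  rw [← pow_mul, ← he] at hall
  have hfin := card_mul_card_le_of_forall_isCloseDilate hA hall
  rw [ZMod.card] at hfin
  have hp0 : (0 : ℝ) < p := by exact_mod_cast (Fact.out : p.Prime).pos
  -- Parseval keeps `A` well below `p / q ^ e`, and `hAcard` keeps it well above `q ^ e`, so each
  -- term on the right of `hfin` is at most a quarter of the left side.
  have h1 : q ^ (e + 8) * #A ≤ p := by
    refine le_of_mul_le_mul_left ?_ (pow_pos hq0 2)
    calc q ^ 2 * (q ^ (e + 8) * #A) = #A * q ^ (e + 10) := by ring
      _ ≤ #X * Fintype.card H := by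
        gcongr
      _ ≤ s ^ 2 * p := hXH
      _ ≤ q ^ 2 * p := by gcongr
  have h2 : 4 * (q ^ e * #A ^ 2) ≤ p * #A := by
    calc 4 * (q ^ e * (#A : ℝ) ^ 2) ≤ q ^ 8 * (q ^ e * #A ^ 2) := by
          gcongr
          exact le_trans (by linarith) (le_self_pow₀ hq1 (by norm_num : 8 ≠ 0))
      _ = q ^ (e + 8) * #A * #A := by ring
      _ ≤ p * #A := by gcongr
  have h3 : 4 * (q ^ e * p) ≤ p * #A := by
    calc 4 * (q ^ e * (p : ℝ)) ≤ q ^ 3 * (q ^ e * p) := by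
          gcongr
          exact le_trans (by linarith) (le_self_pow₀ hq1 (by norm_num : 3 ≠ 0))
      _ = p * q ^ (e + 3) := by ring
      _ ≤ p * #A := by gcongr
  have h4 : 0 < (p : ℝ) * #A := mul_pos hp0 hApos
  linarith

/-- For `t ≥ 2`, `2 * t ^ 2 ≤ t ^ 3`, so `j` steps keep the threshold below `s ^ 3 ^ j ≤ q`. Only
the starting threshold of a step must be at most `q`, which allows one step more. -/
lemma exists_pow_le_card_largeSpectrum (hψ : ψ.IsPrimitive) {n e : ℕ} (hn : 1 ≤ n)
    (he : e = 57 * 1372 ^ (2 * n + 1)) {q : ℝ} (hq : 2 ^ 27 ≤ q)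
    (hp : (p : ℝ) = q ^ (n * (e + 10))) (hH : q ^ (e + 10) ≤ (Fintype.card H : ℝ)) {s : ℝ}
    (hs : 2 ≤ s) {ξ : ZMod p} (hξ0 : ξ ≠ 0) (hξ : ξ ∈ largeSpectrum ψ H s) (j : ℕ)
    (hj : s ^ 3 ^ j ≤ q) :
    ∃ t, q ^ (j + 1) ≤ #(largeSpectrum ψ H t) := by
  have hq0 : 0 < q := by linarith
  have key : ∀ j : ℕ, s ^ 3 ^ j ≤ q → ∃ t, 2 ≤ t ∧ t ≤ s ^ 3 ^ j ∧
      q ^ j ≤ #(largeSpectrum ψ H t) ∧ ξ ∈ largeSpectrum ψ H t := by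
    intro j
    induction j with
    | zero =>
      intro _
      refine ⟨s, hs, by simp, ?_, hξ⟩
      rw [pow_zero]
      exact_mod_cast card_pos.2 ⟨ξ, hξ⟩
    | succ j ih =>
      intro hj
      have hjj : s ^ 3 ^ j ≤ q :=
        (pow_le_pow_right₀ (by linarith) (Nat.pow_le_pow_right (by norm_num) j.le_succ)).trans hj
      obtain ⟨t, ht2, hts, htq, htξ⟩ := ih hjj
      have hgrow := mul_card_largeSpectrum_lt H hψ hn he hq hp hH (by linarith)
        (hts.trans hjj) hξ0 htξ
      refine ⟨2 * t ^ 2, by nlinarith, ?_, ?_, ?_⟩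
      · calc 2 * t ^ 2 ≤ t * t ^ 2 := by gcongr
          _ = t ^ 3 := by ring
          _ ≤ (s ^ 3 ^ j) ^ 3 := by gcongr
          _ = s ^ 3 ^ (j + 1) := by rw [← pow_mul, ← pow_succ]
      · rw [pow_succ']
        exact (mul_le_mul_of_nonneg_left htq hq0.le).trans hgrow.le
      · rw [mem_largeSpectrum] at htξ ⊢
        refine htξ.trans ?_
        gcongr
        nlinarith
  obtain ⟨t, ht2, hts, htq, htξ⟩ := key j hj
  refine ⟨2 * t ^ 2, ?_⟩
  rw [pow_succ']
  exact (mul_le_mul_of_nonneg_left htq hq0.le).trans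
    (mul_card_largeSpectrum_lt H hψ hn he hq hp hH (by linarith) (hts.trans hj) hξ0 htξ).le

end SubgroupSums

/-! ### Choice of exponents and conclusion. -/

theorem theorem1p1 :
    ∃ C : ℝ, 0 < C ∧ ∀ α : ℝ, 0 < α → ∃ β : ℝ, 0 < β ∧
      ∀ (p : ℕ) [Fact p.Prime] (H : Subgroup (ZMod p)ˣ) [Fintype H] (ψ : AddChar (ZMod p) ℂ),
        ψ ≠ 1 → (p : ℝ) ^ α < (Fintype.card H : ℝ) →
          ‖∑ x : H, ψ ((x : (ZMod p)ˣ) : ZMod p)‖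
            ≤ C * (p : ℝ) ^ (-β) * (Fintype.card H : ℝ) := by
  refine ⟨2, two_pos, fun α hα => ?_⟩
  obtain ⟨n, hn1, hnα⟩ : ∃ n : ℕ, 1 ≤ n ∧ (n : ℝ)⁻¹ ≤ α := by
    obtain ⟨n, hn⟩ := exists_nat_one_div_lt hα
    exact ⟨n + 1, by omega, by simpa using hn.le⟩
  obtain ⟨e, he⟩ : ∃ e : ℕ, e = 57 * 1372 ^ (2 * n + 1) := ⟨_, rfl⟩
  obtain ⟨N, hN⟩ : ∃ N : ℕ, N = n * (e + 10) := ⟨_, rfl⟩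
  have hN3 : 3 ≤ N := by
    rw [hN]
    nlinarith
  have hm : 3 ^ N * N ≠ 0 := by positivity
  -- With `s = p ^ β` and `q = s ^ 3 ^ N`, this makes `p = q ^ N`, so `N + 1` growth steps overflow
  -- `F_p`.
  refine ⟨((3 ^ N * N : ℕ) : ℝ)⁻¹, by positivity, fun p _ H _ ψ hψ hH => ?_⟩
  have hp1 : (1 : ℝ) ≤ p := by exact_mod_cast (Fact.out : p.Prime).one_le
  have hp0 : (0 : ℝ) < p := by linarith
  have hHpos : (0 : ℝ) < Fintype.card H := by exact_mod_cast Fintype.card_pos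
  have hsum : ∑ x : H, ψ ((x : (ZMod p)ˣ) : ZMod p) = subgroupSum ψ H 1 := by
    simp [subgroupSum]
  rw [hsum, Real.rpow_neg hp0.le]
  set s : ℝ := (p : ℝ) ^ ((3 ^ N * N : ℕ) : ℝ)⁻¹ with hs
  have hs0 : 0 < s := Real.rpow_pos_of_pos hp0 _
  have hsp : s ^ (3 ^ N * N) = p := Real.rpow_inv_natCast_pow hp0.le hm
  clear_value s
  have hbound := norm_subgroupSum_le ψ H 1
  rw [mul_assoc, mul_comm, mul_assoc, inv_mul_eq_div, le_div_iff₀ hs0]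
  -- For `s < 2` the trivial bound suffices, thanks to the constant `2`.
  rcases lt_or_ge s 2 with hs2 | hs2
  · exact mul_le_mul hbound hs2.le hs0.le hHpos.le
  by_contra! hcon
  have h1 : (1 : ZMod p) ∈ largeSpectrum ψ H s := by
    rw [mem_largeSpectrum]
    linarith
  have hqN : (p : ℝ) = (s ^ 3 ^ N) ^ (n * (e + 10)) := by rw [← hN, ← pow_mul, hsp]
  have hq : 2 ^ 27 ≤ s ^ 3 ^ N := by
    calc (2 : ℝ) ^ 27 ≤ s ^ 27 := by gcongr
      _ ≤ s ^ 3 ^ N := by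
        refine pow_le_pow_right₀ (by linarith) ?_
        calc 27 = 3 ^ 3 := by norm_num
          _ ≤ 3 ^ N := Nat.pow_le_pow_right (by norm_num) hN3
  have hqH : (s ^ 3 ^ N) ^ (e + 10) ≤ (Fintype.card H : ℝ) := by
    refine le_trans ?_ hH.le
    calc (s ^ 3 ^ N) ^ (e + 10) = (p : ℝ) ^ (n : ℝ)⁻¹ := by
          rw [hqN, mul_comm n, pow_mul _ (e + 10) n, Real.pow_rpow_inv_natCast (by positivity)
            (by omega)]
      _ ≤ (p : ℝ) ^ α := Real.rpow_le_rpow_of_exponent_le hp1 hnα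
  obtain ⟨t, ht⟩ := exists_pow_le_card_largeSpectrum H (AddChar.IsPrimitive.of_ne_one hψ) hn1 he hq
    hqN hqH hs2 one_ne_zero h1 N le_rfl
  have hle : (#(largeSpectrum ψ H t) : ℝ) ≤ p := by
    have := card_le_univ (largeSpectrum ψ H t)
    rw [ZMod.card] at this
    exact_mod_cast this
  have hlt : (s ^ 3 ^ N) ^ N < (s ^ 3 ^ N) ^ (N + 1) :=
    pow_lt_pow_right₀ (by linarith) N.lt_succ_self
  rw [← pow_mul, hsp] at hlt
  linarith
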